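/- A $\mathrm{Cu}$-semigroup is a commutative monoid $S$ with a translation-invariant partial order in which every element is $\ge 0$, satisfying: (O1) every increasing sequence has a supremum; (O2) every element is the supremum of a $\ll$-increasing sequence; (O3) $x'\ll x$ and $y'\ll y$ imply $x'+y'\ll x+y$; (O4) $\sup_n x_n+\sup_n y_n=\sup_n(x_n+y_n)$ for increasing sequences $(x_n)_n,(y_n)_n$. Here $x\ll y$ means that for every increasing sequence $(z_n)_n$ whose supremum exists and satisfies $y\le\sup_n z_n$ there is $n$ with $x\le z_n$. A $\mathrm{Cu}$-morphism is an order-preserving monoid homomorphism that preserves $\ll$ and suprema of increasing sequences. $S$ satisfies (O5) if whenever $x+y\le z$, $x'\ll x$ and $y'\ll y$, there is $c\in S$ with $x'+c\le z\le x+c$ and $y'\ll c$; $S$ is weakly cancellative if $x+z\ll y+z$ implies $x\ll y$. Let $\mathrm{Lsc}=\mathrm{Lsc}([0,1],\overline{\mathbb N})$ be the monoid of lower semicontinuous functions $[0,1]\to\overline{\mathbb N}=\{0,1,2,\dots,\infty\}$ with pointwise order and addition. For $r\ge 0$ let $1_j\in\mathrm{Lsc}^r$ be the element with $j$-th component the constant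 function $1$ and all other components $0$. For $\mathrm{Cu}$-morphisms $\varphi,\psi\colon\mathrm{Lsc}\to S$ with $\varphi(1)=\psi(1)$ put $$d(\varphi,\psi)=\inf\{\epsilon\in[0,1] : \varphi(\chi_{(t+\epsilon,1]})\le\psi(\chi_{(t,1]})\text{ and }\psi(\chi_{(t+\epsilon,1]})\le\varphi(\chi_{(t,1]})\text{ for all }t\in[0,1]\},$$ where $\chi_{(s,1]}=0$ for $s\ge 1$, and for $\mathrm{Cu}$-morphisms $\varphi,\psi\colon\mathrm{Lsc}^r\to S$ with $\varphi(1_j)=\psi(1_j)$ for all $j$ put $d(\varphi,\psi)=\max_{1\le j\le r}d(\varphi|_{L_j},\psi|_{L_j})$, where $L_j$ is the $j$-th summand of $\mathrm{Lsc}^r$ (and $d=0$ if $r=0$). **Theorem.** Let $S$ be a weakly cancellative $\mathrm{Cu}$-semigroup satisfying (O5). Let $(\varphi_i)_{i}$ be a sequence of $\mathrm{Cu}$-morphisms $\mathrm{Lsc}^r\to S$ such that $\varphi_i(1_j)=\varphi_{i+1}(1_j)$ for all $i$ and all $1\le j\le r$, and let $(\epsilon_i)_i$ be real numbers with $\sum_i\epsilon_i<\infty$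 and $d(\varphi_i,\varphi_{i+1})<\epsilon_i$ for all $i$. Then there is a unique $\mathrm{Cu}$-morphism $\varphi\colon\mathrm{Lsc}^r\to S$ such that $d(\varphi,\varphi_i)\to 0$ as $i\to\infty$ and $\varphi(1_j)=\varphi_i(1_j)$ for all $i$ and all $1\le j\le r$. -/

import Mathlib

namespace Cuntz

/-- Compact containment `x ≪ y`: for every increasing sequence `z` whose supremum `s` exists and
satisfies `y ≤ s`, there is `n` with `x ≤ z n`. -/
def WayBelow {S : Type*} [PartialOrder S] (x y : S) : Prop :=
  ∀ z : ℕ → S, Monotone z → ∀ s : S, IsLUB (Set.range z) s → y ≤ s → ∃ n, x ≤ z n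

/-- `Cu`-semigroups: positively ordered (commutative) monoids satisfying (O1)-(O4). -/
structure IsCuSemigroup (S : Type*) [AddCommMonoid S] [PartialOrder S] : Prop where
  /-- The order is translation invariant. -/
  add_le_add_left : ∀ x y : S, x ≤ y → ∀ z : S, x + z ≤ y + z
  /-- Every element is positive. -/
  zero_le : ∀ x : S, 0 ≤ x
  /-- (O1): increasing sequences have suprema. -/
  exists_sup : ∀ z : ℕ → S, Monotone z → ∃ s : S, IsLUB (Set.range z) s
  /-- (O2): every element is the supremum of a `≪`-increasing sequence. -/
  exists_wayBelow_seq : ∀ x : S, ∃ z : ℕ → S,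
    (∀ n, WayBelow (z n) (z (n + 1))) ∧ IsLUB (Set.range z) x
  /-- (O3): addition is compatible with `≪`. -/
  wayBelow_add : ∀ x' x y' y : S, WayBelow x' x → WayBelow y' y → WayBelow (x' + y') (x + y)
  /-- (O4): addition is compatible with suprema of increasing sequences. -/
  isLUB_add : ∀ x y : ℕ → S, Monotone x → Monotone y → ∀ a b : S,
    IsLUB (Set.range x) a → IsLUB (Set.range y) b → IsLUB (Set.range fun n => x n + y n) (a + b)

/-- Axiom (O5). -/
def O5 (S : Type*) [AddCommMonoid S] [PartialOrder S] : Prop :=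
  ∀ x' x y' y z : S, x + y ≤ z → WayBelow x' x → WayBelow y' y →
    ∃ c : S, x' + c ≤ z ∧ z ≤ x + c ∧ WayBelow y' c

/-- Weak cancellation. -/
def WeaklyCancellative (S : Type*) [AddCommMonoid S] [PartialOrder S] : Prop :=
  ∀ x y z : S, WayBelow (x + z) (y + z) → WayBelow x y

/-- `Cu`-morphisms: order preserving monoid morphisms that preserve the way-below relation and
suprema of increasing sequences. -/
structure CuMorphism (S T : Type*) [AddCommMonoid S] [PartialOrder S]
    [AddCommMonoid T] [PartialOrder T] extends S →+ T where
  monotone' : Monotone toFun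
  map_wayBelow' : ∀ x y : S, WayBelow x y → WayBelow (toFun x) (toFun y)
  map_isLUB' : ∀ z : ℕ → S, Monotone z → ∀ s : S, IsLUB (Set.range z) s →
    IsLUB (Set.range fun n => toFun (z n)) (toFun s)

instance {S T : Type*} [AddCommMonoid S] [PartialOrder S] [AddCommMonoid T] [PartialOrder T] :
    FunLike (CuMorphism S T) S T where
  coe φ := φ.toFun
  coe_injective φ ψ h := by
    rcases φ with ⟨⟨⟨f, _⟩, _⟩, _, _, _⟩
    rcases ψ with ⟨⟨⟨g, _⟩, _⟩, _, _, _⟩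
    have hfg : f = g := h
    subst hfg
    rfl

/-- `Lsc([0,1], ℕ ∪ {∞})`: the lower semicontinuous functions from `[0,1]` to `ℕ ∪ {∞}`, with
pointwise addition and pointwise order. -/
def lscSubmonoid : AddSubmonoid (unitInterval → ℕ∞) where
  carrier := {f | LowerSemicontinuous f}
  zero_mem' := lowerSemicontinuous_const
  add_mem' hf hg := LowerSemicontinuous.add hf hg

/-- The type of elements of `Lsc([0,1], ℕ ∪ {∞})`. -/
abbrev LscI : Type := lscSubmonoid

/-- The constant function `1`. -/
def LscI.one : LscI := ⟨fun _ => 1, lowerSemicontinuous_const⟩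

open Classical in
/-- The indicator function of `(t, 1] ⊆ [0,1]`; it is `0` if `t ≥ 1`. -/
noncomputable def LscI.chiIoc (t : ℝ) : LscI :=
  ⟨Set.indicator {x : unitInterval | t < (x : ℝ)} (fun _ => 1),
    (isOpen_lt continuous_const continuous_subtype_val).lowerSemicontinuous_indicator
      zero_le⟩

/-- The distance between two maps `LscI → S` (used for maps that agree at `1`). -/
noncomputable def distI {S : Type*} [AddCommMonoid S] [PartialOrder S] (φ₁ φ₂ : LscI →+ S) : ℝ :=
  sInf {ε : ℝ | ε ∈ Set.Icc (0 : ℝ) 1 ∧ ∀ t ∈ Set.Icc (0 : ℝ) 1,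
    φ₁ (LscI.chiIoc (t + ε)) ≤ φ₂ (LscI.chiIoc t) ∧
    φ₂ (LscI.chiIoc (t + ε)) ≤ φ₁ (LscI.chiIoc t)}

/-- The restriction of `φ` to the `j`-th summand of `LscI^r`. -/
def CuMorphism.restrict {S : Type*} [AddCommMonoid S] [PartialOrder S] {r : ℕ}
    (φ : CuMorphism (Fin r → LscI) S) (j : Fin r) : LscI →+ S :=
  φ.toAddMonoidHom.comp (AddMonoidHom.single (fun _ : Fin r => LscI) j)

/-- The unit `1_j` of the `j`-th summand of `LscI^r`. -/
def unit {r : ℕ} (j : Fin r) : Fin r → LscI := Pi.single j LscI.one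

/-- The distance between two `Cu`-morphisms `LscI^r → S` (used for maps that agree at the units):
the maximum of the distances between the restrictions to the summands. -/
noncomputable def cuDist {S : Type*} [AddCommMonoid S] [PartialOrder S] {r : ℕ}
    (φ₁ φ₂ : CuMorphism (Fin r → LscI) S) : ℝ :=
  ⨆ j : Fin r, distI (φ₁.restrict j) (φ₂.restrict j)

end Cuntz

namespace Cuntz

/-! ### The way-below relation and elementary order facts in `Cu`-semigroups -/

section General

/-! The distance only sees the functions `χ_(t,1]`, but weak cancellation makes it control
everything: for `f ≪ g` in `Lsc^r` there is `η > 0` such that `φ f ≤ ψ g` whenever `φ` and `ψ` are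
`η`-close (`exists_le_of_wayBelow`). For intervals, `χ_(s,t)` is almost the difference of `χ_(s,1]`
and `χ_(t,1]`, and weak cancellation permits the subtraction (`controlled_realIoo`). An open set is
a disjoint union of intervals, finitely many of which cover a given compact subset
(`controlled_chi`). A general function is a sum of indicators of its superlevel sets
(`controlled_of_rel`).

Summability therefore makes `φ i f ≤ φ k g` for all large `i`, `k` whenever `f ≪ g`. For such a
sequence, sending `g` to the supremum of the elements eventually below `φ i f` for some `f ≪ g`
defines a `Cu`-morphism (`WayBelowCauchy.exists_limit`). It keeps the units because `1_j ≪ 1_j`. Two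
limits are `η`-close for every `η > 0`, so they agree on each `f`, a supremum of elements `≪ f`. -/

theorem WayBelow.le {S : Type*} [PartialOrder S] {x y : S} (h : WayBelow x y) : x ≤ y := by
  obtain ⟨_, hn⟩ := h (fun _ => y) monotone_const y (by simp) le_rfl
  exact hn

theorem WayBelow.mono {S : Type*} [PartialOrder S] {x x' y y' : S} (h : WayBelow x y) (hx : x' ≤ x)
    (hy : y ≤ y') : WayBelow x' y' := fun z hz s hs hys => by
  obtain ⟨n, hn⟩ := h z hz s hs (hy.trans hys)
  exact ⟨n, hx.trans hn⟩

theorem wayBelow_seq_monotone {S : Type*} [PartialOrder S] {z : ℕ → S}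
    (hz : ∀ n, WayBelow (z n) (z (n + 1))) : Monotone z :=
  monotone_nat_of_le_succ fun n => (hz n).le

theorem wayBelow_seq_lub {S : Type*} [PartialOrder S] {z : ℕ → S}
    (hz : ∀ n, WayBelow (z n) (z (n + 1))) {x : S}
    (hx : IsLUB (Set.range z) x) (n : ℕ) : WayBelow (z n) x :=
  (hz n).mono le_rfl (hx.1 ⟨n + 1, rfl⟩)

variable {S : Type*} [AddCommMonoid S] [PartialOrder S]

theorem IsCuSemigroup.add_le_add (hS : IsCuSemigroup S) {a b c d : S} (hab : a ≤ b)
    (hcd : c ≤ d) : a + c ≤ b + d := by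
  refine (hS.add_le_add_left a b hab c).trans ?_
  rw [add_comm b c, add_comm b d]
  exact hS.add_le_add_left c d hcd b

theorem IsCuSemigroup.sum_le_sum (hS : IsCuSemigroup S) {ι : Type*} (s : Finset ι) {a b : ι → S}
    (h : ∀ i ∈ s, a i ≤ b i) : ∑ i ∈ s, a i ≤ ∑ i ∈ s, b i := by
  classical
  induction s using Finset.induction_on with
  | empty => simp
  | insert i s hi ih =>
    rw [Finset.sum_insert hi, Finset.sum_insert hi]
    exact hS.add_le_add (h i (by simp)) (ih fun k hk => h k (by simp [hk]))

/-- Interpolation for the way-below relation. -/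
theorem IsCuSemigroup.exists_between (hS : IsCuSemigroup S) {x y : S} (h : WayBelow x y) :
    ∃ w, WayBelow x w ∧ WayBelow w y := by
  obtain ⟨z, hz, hlub⟩ := hS.exists_wayBelow_seq y
  obtain ⟨n, hn⟩ := h z (wayBelow_seq_monotone hz) y hlub le_rfl
  exact ⟨z (n + 1), (hz n).mono hn le_rfl, wayBelow_seq_lub hz hlub _⟩

theorem CuMorphism.mono {T : Type*} [AddCommMonoid T] [PartialOrder T] (φ : CuMorphism T S)
    {x y : T} (h : x ≤ y) : φ x ≤ φ y := φ.monotone' h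

theorem CuMorphism.map_add {T : Type*} [AddCommMonoid T] [PartialOrder T] (φ : CuMorphism T S)
    (x y : T) : φ (x + y) = φ x + φ y := φ.toAddMonoidHom.map_add x y

theorem CuMorphism.map_zero {T : Type*} [AddCommMonoid T] [PartialOrder T] (φ : CuMorphism T S) :
    φ 0 = 0 := φ.toAddMonoidHom.map_zero

theorem CuMorphism.map_wayBelow {T : Type*} [AddCommMonoid T] [PartialOrder T]
    (φ : CuMorphism T S) {x y : T} (h : WayBelow x y) : WayBelow (φ x) (φ y) :=
  φ.map_wayBelow' x y h

end General

/-! ### Limits of sequences that are Cauchy for the way-below relation -/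

section Limit

variable {S T : Type*} [AddCommMonoid S] [PartialOrder S] [AddCommMonoid T] [PartialOrder T]

/-- The elements lying eventually below the images of some `f ≪ g`. -/
def lowerApprox (φ : ℕ → CuMorphism T S) (g : T) : Set S :=
  {s | ∃ f, WayBelow f g ∧ ∃ N, ∀ i ≥ N, s ≤ φ i f}

/-- The sequence is Cauchy with respect to the way-below relation. -/
def WayBelowCauchy (φ : ℕ → CuMorphism T S) : Prop :=
  ∀ f g : T, WayBelow f g → ∃ N, ∀ i ≥ N, ∀ j ≥ N, φ i f ≤ φ j g

/-- Both sets have the same upper bounds, since every `f ≪ g` lies below some `z n`. The choice-free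
description of the limit thus becomes the supremum of a sequence, to which (O1) and (O4) apply. -/
theorem diagonal_isLUB_iff (φ : ℕ → CuMorphism T S) {g : T} {z : ℕ → T}
    (hz : ∀ n, WayBelow (z n) (z (n + 1))) (hlub : IsLUB (Set.range z) g) {k : ℕ → ℕ}
    (hk : ∀ n, n ≤ k n) (hC : ∀ n, ∀ i ≥ k n, ∀ j ≥ k n, φ i (z n) ≤ φ j (z (n + 1))) (s : S) :
    IsLUB (Set.range fun n => φ (k n) (z n)) s ↔ IsLUB (lowerApprox φ g) s := by
  have : upperBounds (Set.range fun n => φ (k n) (z n)) = upperBounds (lowerApprox φ g) := by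
    ext b
    constructor
    · rintro hb x ⟨f, hf, N, hN⟩
      obtain ⟨n, hn⟩ := hf z (wayBelow_seq_monotone hz) g hlub le_rfl
      refine (hN (k (max n N)) ((le_max_right _ _).trans (hk _))).trans ?_
      refine ((φ _).mono (hn.trans (wayBelow_seq_monotone hz (le_max_left n N)))).trans ?_
      exact hb ⟨max n N, rfl⟩
    · rintro hb _ ⟨n, rfl⟩
      exact hb ⟨z (n + 1), wayBelow_seq_lub hz hlub _, k n, fun i hi => hC n _ le_rfl i hi⟩
  simp only [IsLUB, this]

/-- Allowing every `k ≥ N` lets two sequences share one index function, as additivity of the limit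
requires. -/
theorem exists_index (φ : ℕ → CuMorphism T S) (hφ : WayBelowCauchy φ) {z : ℕ → T}
    (hz : ∀ n, WayBelow (z n) (z (n + 1))) :
    ∃ N : ℕ → ℕ, ∀ k : ℕ → ℕ, (∀ n, N n ≤ k n) →
      ∀ n, ∀ i ≥ k n, ∀ j ≥ k n, φ i (z n) ≤ φ j (z (n + 1)) := by
  choose N hN using fun n => hφ _ _ (hz n)
  exact ⟨N, fun k hk n i hi j hj => hN n i ((hk n).trans hi) j ((hk n).trans hj)⟩

theorem exists_common_index (M N : ℕ → ℕ) :
    ∃ k : ℕ → ℕ, Monotone k ∧ (∀ n, n ≤ k n) ∧ (∀ n, M n ≤ k n) ∧ ∀ n, N n ≤ k n := by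
  refine ⟨fun n => ∑ i ∈ Finset.range (n + 1), (i + M i + N i), ?_, ?_⟩
  · exact fun a b h => Finset.sum_le_sum_of_subset (by simpa using h)
  · have key : ∀ n, n + M n + N n ≤ ∑ i ∈ Finset.range (n + 1), (i + M i + N i) := fun n =>
      Finset.single_le_sum (f := fun i => i + M i + N i) (fun _ _ => Nat.zero_le _) (by simp)
    exact ⟨fun n => (by omega : n ≤ n + M n + N n).trans (key n),
      fun n => (by omega : M n ≤ n + M n + N n).trans (key n),
      fun n => (by omega : N n ≤ n + M n + N n).trans (key n)⟩

theorem diagonal_monotone (φ : ℕ → CuMorphism T S) {z : ℕ → T} {k : ℕ → ℕ} (hk : Monotone k)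
    (hC : ∀ n, ∀ i ≥ k n, ∀ j ≥ k n, φ i (z n) ≤ φ j (z (n + 1))) :
    Monotone fun n => φ (k n) (z n) :=
  monotone_nat_of_le_succ fun n => hC n _ le_rfl _ (hk n.le_succ)

/-- A sequence of `Cu`-morphisms that is Cauchy with respect to the way-below relation has a
limit. -/
theorem WayBelowCauchy.exists_limit (hS : IsCuSemigroup S) (hT : IsCuSemigroup T)
    {φ : ℕ → CuMorphism T S} (hφ : WayBelowCauchy φ) :
    ∃ ψ : CuMorphism T S, ∀ f g, WayBelow f g →
      ∃ N, ∀ i ≥ N, φ i f ≤ ψ g ∧ ψ f ≤ φ i g := by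
  have hex : ∀ g, ∃ s, IsLUB (lowerApprox φ g) s := by
    intro g
    obtain ⟨z, hz, hlub⟩ := hT.exists_wayBelow_seq g
    obtain ⟨N, hN⟩ := exists_index φ hφ hz
    obtain ⟨k, hk, hk1, hk2, -⟩ := exists_common_index N N
    obtain ⟨s, hs⟩ := hS.exists_sup _ (diagonal_monotone φ hk (hN k hk2))
    exact ⟨s, (diagonal_isLUB_iff φ hz hlub hk1 (hN k hk2) s).1 hs⟩
  choose ψ hψ using hex
  have hle : ∀ f g, WayBelow f g → ∃ N, ∀ i ≥ N, φ i f ≤ ψ g := by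
    intro f g h
    obtain ⟨w, hfw, hwg⟩ := hT.exists_between h
    obtain ⟨N, hN⟩ := hφ f w hfw
    exact ⟨N, fun i hi => (hψ g).1 ⟨w, hwg, N, fun j hj => hN i hi j hj⟩⟩
  have hge : ∀ f g, WayBelow f g → ∃ N, ∀ i ≥ N, ψ f ≤ φ i g := by
    intro f g h
    obtain ⟨N, hN⟩ := hφ f g h
    refine ⟨N, fun i hi => (hψ f).2 ?_⟩
    rintro s ⟨f', hf', M, hM⟩
    exact (hM (max M N) (le_max_left _ _)).trans
      (((φ _).mono hf'.le).trans (hN _ (le_max_right _ _) i hi))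
  have hmono : Monotone ψ := fun f g h => (hψ f).2 fun s ⟨f', hf', hs⟩ =>
    (hψ g).1 ⟨f', hf'.mono le_rfl h, hs⟩
  have hadd : ∀ f g, ψ (f + g) = ψ f + ψ g := by
    intro f g
    obtain ⟨y, hy, hylub⟩ := hT.exists_wayBelow_seq f
    obtain ⟨z, hz, hzlub⟩ := hT.exists_wayBelow_seq g
    obtain ⟨M, hM⟩ := exists_index φ hφ hy
    obtain ⟨N, hN⟩ := exists_index φ hφ hz
    obtain ⟨k, hk, hk1, hk2, hk3⟩ := exists_common_index M N
    have h1 := (diagonal_isLUB_iff φ hy hylub hk1 (hM k hk2) _).2 (hψ f)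
    have h2 := (diagonal_isLUB_iff φ hz hzlub hk1 (hN k hk3) _).2 (hψ g)
    have h3 := hS.isLUB_add _ _ (diagonal_monotone φ hk (hM k hk2))
      (diagonal_monotone φ hk (hN k hk3)) _ _ h1 h2
    have hyz : ∀ n, WayBelow (y n + z n) (y (n + 1) + z (n + 1)) := fun n =>
      hT.wayBelow_add _ _ _ _ (hy n) (hz n)
    have h4 := (diagonal_isLUB_iff (z := fun n => y n + z n) φ hyz
      (hT.isLUB_add _ _ (wayBelow_seq_monotone hy) (wayBelow_seq_monotone hz) _ _ hylub hzlub) hk1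
      (fun n i hi j hj => by
        simp only [CuMorphism.map_add]
        exact hS.add_le_add (hM k hk2 n i hi j hj) (hN k hk3 n i hi j hj)) _).2 (hψ (f + g))
    simp only [CuMorphism.map_add] at h4
    exact h4.unique h3
  have hzero : ψ 0 = 0 := by
    refine le_antisymm ((hψ 0).2 ?_) (hS.zero_le _)
    rintro s ⟨f, hf, N, hN⟩
    calc s ≤ φ N f := hN N le_rfl
      _ ≤ φ N 0 := (φ N).mono hf.le
      _ = 0 := (φ N).map_zero
  have hwb : ∀ f g, WayBelow f g → WayBelow (ψ f) (ψ g) := by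
    intro f g h
    -- With `f ≪ v ≪ w ≪ g`, a single late morphism gives `ψ f ≤ φ i v ≪ φ i w ≤ ψ g`.
    obtain ⟨v, hfv, hvg⟩ := hT.exists_between h
    obtain ⟨w, hvw, hwg⟩ := hT.exists_between hvg
    obtain ⟨N, hN⟩ := hge f v hfv
    obtain ⟨M, hM⟩ := hle w g hwg
    exact ((φ (max M N)).map_wayBelow hvw).mono (hN _ (le_max_right _ _)) (hM _ (le_max_left _ _))
  have hsup : ∀ z : ℕ → T, Monotone z → ∀ s : T, IsLUB (Set.range z) s →
      IsLUB (Set.range fun n => ψ (z n)) (ψ s) := by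
    intro z hz s hs
    refine ⟨?_, fun b hb => (hψ s).2 ?_⟩
    · rintro _ ⟨n, rfl⟩
      exact hmono (hs.1 ⟨n, rfl⟩)
    · rintro a ⟨f, hf, N, hN⟩
      obtain ⟨w, hfw, hws⟩ := hT.exists_between hf
      obtain ⟨n, hn⟩ := hws z hz s hs le_rfl
      exact ((hψ (z n)).1 ⟨f, hfw.mono le_rfl hn, N, hN⟩).trans (hb ⟨n, rfl⟩)
  refine ⟨⟨⟨⟨ψ, hzero⟩, hadd⟩, hmono, hwb, hsup⟩, fun f g h => ?_⟩
  obtain ⟨M, hM⟩ := hle f g h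
  obtain ⟨N, hN⟩ := hge f g h
  exact ⟨max M N, fun i hi => ⟨hM i ((le_max_left _ _).trans hi),
    hN i ((le_max_right _ _).trans hi)⟩⟩

end Limit

open Filter Topology

/-! ### Suprema, the way-below relation and layer approximations in `Lsc` -/

namespace LscI

theorem add_apply (f g : LscI) (x : unitInterval) : (f + g).1 x = f.1 x + g.1 x := rfl

theorem sum_apply {ι : Type*} (s : Finset ι) (f : ι → LscI) (x : unitInterval) :
    (∑ i ∈ s, f i).1 x = ∑ i ∈ s, (f i).1 x := by
  rw [AddSubmonoid.coe_finsetSum, Finset.sum_apply]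

/-- The pointwise supremum. -/
noncomputable def iSup (z : ℕ → LscI) : LscI :=
  ⟨fun x => ⨆ n, (z n).1 x, lowerSemicontinuous_iSup fun n => (z n).2⟩

theorem isLUB_iSup (z : ℕ → LscI) : IsLUB (Set.range z) (iSup z) := by
  refine ⟨?_, fun b hb x => iSup_le fun n => hb ⟨n, rfl⟩ x⟩
  rintro _ ⟨n, rfl⟩ x
  exact le_iSup (fun n => (z n).1 x) n

theorem apply_eq_iSup {z : ℕ → LscI} {s : LscI} (h : IsLUB (Set.range z) s) (x : unitInterval) :
    s.1 x = ⨆ n, (z n).1 x := by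
  rw [h.unique (isLUB_iSup z)]
  rfl

/-- The indicator function of an open set. -/
noncomputable def chi (U : Set unitInterval) (hU : IsOpen U) : LscI :=
  ⟨Set.indicator U fun _ => 1, hU.lowerSemicontinuous_indicator zero_le⟩

theorem chi_of_mem {U : Set unitInterval} (hU : IsOpen U) {x : unitInterval} (h : x ∈ U) :
    (chi U hU).1 x = 1 := Set.indicator_of_mem (f := fun _ => (1 : ℕ∞)) h

theorem chi_of_notMem {U : Set unitInterval} (hU : IsOpen U) {x : unitInterval} (h : x ∉ U) :
    (chi U hU).1 x = 0 := Set.indicator_of_notMem (f := fun _ => (1 : ℕ∞)) h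

theorem chi_le_one {U : Set unitInterval} (hU : IsOpen U) (x : unitInterval) :
    (chi U hU).1 x ≤ 1 := by
  by_cases h : x ∈ U
  · exact (chi_of_mem hU h).le
  · exact (chi_of_notMem hU h).le.trans zero_le_one

/-- A pointwise description of the way-below relation: near every point, `f` is bounded by a
natural number below the value of `g`. -/
def Rel (f g : LscI) : Prop :=
  ∀ x, ∃ n : ℕ, (n : ℕ∞) ≤ g.1 x ∧ ∀ᶠ y in 𝓝 x, f.1 y ≤ n

theorem Rel.mono {f f' g g' : LscI} (h : Rel f g) (hf : f' ≤ f) (hg : g ≤ g') : Rel f' g' := by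
  intro x
  obtain ⟨n, hn, hy⟩ := h x
  exact ⟨n, hn.trans (hg x), hy.mono fun y hy => (hf y).trans hy⟩

theorem Rel.add {f f' g g' : LscI} (h : Rel f g) (h' : Rel f' g') : Rel (f + f') (g + g') := by
  intro x
  obtain ⟨n, hn, hy⟩ := h x
  obtain ⟨m, hm, hy'⟩ := h' x
  refine ⟨n + m, ?_, ?_⟩
  · push_cast
    exact add_le_add hn hm
  · filter_upwards [hy, hy'] with y h1 h2
    push_cast
    exact add_le_add h1 h2

theorem rel_zero (g : LscI) : Rel 0 g := fun x => ⟨0, by simp, .of_forall fun _ => le_rfl⟩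

theorem Rel.sum {ι : Type*} (s : Finset ι) {f g : ι → LscI} (h : ∀ i ∈ s, Rel (f i) (g i)) :
    Rel (∑ i ∈ s, f i) (∑ i ∈ s, g i) := by
  classical
  induction s using Finset.induction_on with
  | empty => simpa using rel_zero 0
  | insert i s hi ih =>
    rw [Finset.sum_insert hi, Finset.sum_insert hi]
    exact (h i (by simp)).add (ih fun k hk => h k (by simp [hk]))

theorem rel_chi {U V : Set unitInterval} (hU : IsOpen U) (hV : IsOpen V) (h : closure U ⊆ V) :
    Rel (chi U hU) (chi V hV) := by
  intro x
  by_cases hx : x ∈ V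
  · exact ⟨1, by simp [chi_of_mem hV hx], .of_forall fun y => by simpa using chi_le_one hU y⟩
  · refine ⟨0, by simp, ?_⟩
    filter_upwards [isClosed_closure.isOpen_compl.mem_nhds fun hc => hx (h hc)] with y hy
    rw [chi_of_notMem hU fun hyU => hy (subset_closure hyU)]
    simp

theorem exists_nat_le_of_le_iSup {a : ℕ → ℕ∞} {n : ℕ} (h : (n : ℕ∞) ≤ ⨆ m, a m) :
    ∃ m, (n : ℕ∞) ≤ a m := by
  cases n with
  | zero => exact ⟨0, by simp⟩
  | succ n =>
    have : (n : ℕ∞) < ⨆ m, a m := lt_of_lt_of_le (by exact_mod_cast n.lt_succ_self) h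
    obtain ⟨m, hm⟩ := lt_iSup_iff.1 this
    exact ⟨m, by simpa using Order.add_one_le_of_lt hm⟩

theorem eventually_nat_le (f : LscI) {x : unitInterval} {n : ℕ} (h : (n : ℕ∞) ≤ f.1 x) :
    ∀ᶠ y in 𝓝 x, (n : ℕ∞) ≤ f.1 y := by
  cases n with
  | zero => exact .of_forall fun y => by simp
  | succ n =>
    have : (n : ℕ∞) < f.1 x := lt_of_lt_of_le (by exact_mod_cast n.lt_succ_self) h
    filter_upwards [f.2 x _ this] with y hy
    simpa using Order.add_one_le_of_lt hy

/-- Near `x`, `f ≤ n ≤ g x`. As `n` is finite, some `z m` reaches `n` at `x`, and by semicontinuity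
also nearby. Compactness of `[0,1]` leaves finitely many `m`. -/
theorem Rel.wayBelow {f g : LscI} (h : Rel f g) : WayBelow f g := by
  intro z hz s hs hgs
  have hloc : ∀ x, ∃ m, ∀ᶠ y in 𝓝 x, f.1 y ≤ (z m).1 y := by
    intro x
    obtain ⟨n, hn, hy⟩ := h x
    have h1 := hn.trans (hgs x)
    rw [apply_eq_iSup hs] at h1
    obtain ⟨m, hm⟩ := exists_nat_le_of_le_iSup h1
    exact ⟨m, by filter_upwards [hy, eventually_nat_le (z m) hm] with y a b using a.trans b⟩
  choose m hm using hloc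
  obtain ⟨t, -, ht⟩ := isCompact_univ.elim_nhds_subcover
    (fun x => {y | f.1 y ≤ (z (m x)).1 y}) fun x _ => hm x
  refine ⟨t.sup m, fun y => ?_⟩
  obtain ⟨x, hx, hy⟩ := Set.mem_iUnion₂.1 (ht (Set.mem_univ y))
  exact le_trans hy (hz (Finset.le_sup hx) y)

/-- Inner approximations of an open set. -/
def inner (U : Set unitInterval) (n : ℕ) : Set unitInterval :=
  {x | ((n : ENNReal) + 1)⁻¹ < Metric.infEDist x Uᶜ}

theorem mem_inner {U : Set unitInterval} {n : ℕ} {x : unitInterval} :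
    x ∈ inner U n ↔ ((n : ENNReal) + 1)⁻¹ < Metric.infEDist x Uᶜ := Iff.rfl

theorem isOpen_inner (U : Set unitInterval) (n : ℕ) : IsOpen (inner U n) :=
  isOpen_lt continuous_const Metric.continuous_infEDist

theorem closure_inner_subset (U : Set unitInterval) (n : ℕ) :
    closure (inner U n) ⊆ inner U (n + 1) := by
  have h1 : closure (inner U n) ⊆ {x | ((n : ENNReal) + 1)⁻¹ ≤ Metric.infEDist x Uᶜ} :=
    closure_minimal (Set.ofPred_subset_ofPred.2 fun x hx => le_of_lt hx)
      (isClosed_le continuous_const Metric.continuous_infEDist)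
  intro x hx
  rw [mem_inner]
  refine lt_of_lt_of_le ?_ (Set.mem_ofPred.1 (h1 hx))
  rw [ENNReal.inv_lt_inv]
  exact_mod_cast Nat.lt_succ_self (n + 1)

theorem inner_monotone (U : Set unitInterval) : Monotone (inner U) :=
  monotone_nat_of_le_succ fun n => subset_closure.trans (closure_inner_subset U n)

theorem inner_subset (U : Set unitInterval) (n : ℕ) : inner U n ⊆ U := by
  intro x hx
  by_contra h
  have : Metric.infEDist x Uᶜ = 0 := Metric.infEDist_zero_of_mem h
  simp [inner, this] at hx

theorem exists_mem_inner {U : Set unitInterval} (hU : IsOpen U) {x : unitInterval} (hx : x ∈ U) :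
    ∃ n, x ∈ inner U n := by
  have h0 : 0 < Metric.infEDist x Uᶜ := by
    rw [Metric.infEDist_pos_iff_notMem_closure, hU.isClosed_compl.closure_eq]
    exact fun h => h hx
  obtain ⟨n, hn⟩ := ENNReal.exists_inv_nat_lt h0.ne'
  refine ⟨n, lt_of_le_of_lt ?_ hn⟩
  exact ENNReal.inv_le_inv.2 le_self_add

/-- The superlevel set `{g > k}`. -/
def level (g : LscI) (k : ℕ) : Set unitInterval := {x | (k : ℕ∞) < g.1 x}

theorem isOpen_level (g : LscI) (k : ℕ) : IsOpen (level g k) := g.2.isOpen_preimage _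

/-- A canonical approximating sequence. -/
noncomputable def approx (g : LscI) (n : ℕ) : LscI :=
  ∑ k ∈ Finset.range n, chi (inner (level g k) n) (isOpen_inner _ _)

/-- Layer-cake formula: the sum at `x` counts the `k < n` with `k < g x`, so it is `min n (g x)`. -/
theorem sum_range_chi_le (g : LscI) (n : ℕ) :
    ∑ k ∈ Finset.range n, chi (level g k) (isOpen_level g k) ≤ g := by
  intro x
  rw [sum_apply]
  induction n with
  | zero => simp
  | succ n ih =>
    rw [Finset.sum_range_succ]
    by_cases hx : (n : ℕ∞) < g.1 x
    · have h1 : ∑ k ∈ Finset.range n, (chi (level g k) (isOpen_level g k)).1 x ≤ n := by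
        simpa using Finset.sum_le_card_nsmul (Finset.range n) _ 1 fun k _ =>
          chi_le_one (isOpen_level g k) x
      exact (add_le_add h1 (chi_le_one _ x)).trans (Order.add_one_le_of_lt hx)
    · rw [chi_of_notMem _ hx, add_zero]
      exact ih

theorem chi_mono {U V : Set unitInterval} (hU : IsOpen U) (hV : IsOpen V) (h : U ⊆ V) :
    chi U hU ≤ chi V hV := by
  intro x
  by_cases hx : x ∈ U
  · rw [chi_of_mem hU hx, chi_of_mem hV (h hx)]
  · rw [chi_of_notMem hU hx]
    exact zero_le

theorem zero_le' (f : LscI) : 0 ≤ f := fun _ => zero_le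

theorem add_le_add' {a b c d : LscI} (h : a ≤ b) (h' : c ≤ d) : a + c ≤ b + d :=
  fun x => add_le_add (h x) (h' x)

theorem sum_le_sum' {ι : Type*} (s : Finset ι) {a b : ι → LscI} (h : ∀ i ∈ s, a i ≤ b i) :
    ∑ i ∈ s, a i ≤ ∑ i ∈ s, b i := fun x => by
  rw [sum_apply, sum_apply]
  exact Finset.sum_le_sum fun i hi => h i hi x

theorem rel_approx (g : LscI) (n : ℕ) : Rel (approx g n) (approx g (n + 1)) := by
  refine (Rel.sum (Finset.range n) fun k _ => rel_chi (isOpen_inner (level g k) n)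
    (isOpen_inner (level g k) (n + 1)) (closure_inner_subset _ n)).mono le_rfl ?_
  rw [approx, Finset.sum_range_succ]
  exact le_of_eq_of_le (add_zero _).symm (add_le_add' le_rfl (zero_le' _))

theorem approx_le (g : LscI) (n : ℕ) : approx g n ≤ g :=
  (sum_le_sum' _ fun k _ => chi_mono _ (isOpen_level g k) (inner_subset _ n)).trans
    (sum_range_chi_le g n)

theorem isLUB_approx (g : LscI) : IsLUB (Set.range (approx g)) g := by
  refine ⟨?_, fun b hb x => ?_⟩
  · rintro _ ⟨n, rfl⟩
    exact approx_le g n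
  · refine ENat.forall_natCast_le_iff_le.1 fun m hm => ?_
    have hmem : ∀ k < m, ∃ n, x ∈ inner (level g k) n := fun k hk =>
      exists_mem_inner (isOpen_level g k) (lt_of_lt_of_le (by exact_mod_cast hk) hm)
    choose! n hn using hmem
    -- This index is at least `m`, so the first `m` layers occur, and at least each `n k`, so `x`
    -- lies in all of their inner approximations.
    have hb' := hb ⟨m + ∑ k ∈ Finset.range m, n k, rfl⟩ x
    refine le_trans ?_ hb'
    rw [approx, sum_apply]
    refine le_trans ?_ (Finset.sum_le_sum_of_subset (s := Finset.range m) (by simp))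
    rw [Finset.sum_congr rfl (g := fun _ => 1)]
    · simp
    · intro k hk
      refine chi_of_mem _ (inner_monotone _ ?_ (hn k (by simpa using hk)))
      exact (Finset.single_le_sum (f := n) (fun _ _ => Nat.zero_le _) hk).trans
        (Nat.le_add_left _ _)

end LscI

/-! ### `Lsc^r` as a `Cu`-semigroup -/

section Pi

variable {r : ℕ}

theorem pi_wayBelow_of_rel {f g : Fin r → LscI} (h : ∀ j, LscI.Rel (f j) (g j)) :
    WayBelow f g := by
  intro z hz s hs hgs
  have hj : ∀ j, ∃ n, f j ≤ z n j := by
    intro j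
    refine (h j).wayBelow (fun n => z n j) (fun a b hab => hz hab j) (s j) ?_ (hgs j)
    have := isLUB_pi.1 hs j
    rwa [← Set.range_comp] at this
  choose n hn using hj
  exact ⟨Finset.univ.sup n, fun j => (hn j).trans (hz (Finset.le_sup (Finset.mem_univ j)) j)⟩

theorem pi_isLUB_iff {z : ℕ → Fin r → LscI} {s : Fin r → LscI} :
    IsLUB (Set.range z) s ↔ ∀ j, IsLUB (Set.range fun n => z n j) (s j) := by
  rw [isLUB_pi]
  simp only [← Set.range_comp]
  rfl

theorem pi_isLUB_approx (g : Fin r → LscI) :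
    IsLUB (Set.range fun n j => LscI.approx (g j) n) g :=
  pi_isLUB_iff.2 fun j => LscI.isLUB_approx (g j)

theorem pi_approx_wayBelow (g : Fin r → LscI) (n : ℕ) :
    WayBelow (fun j => LscI.approx (g j) n) fun j => LscI.approx (g j) (n + 1) :=
  pi_wayBelow_of_rel fun j => LscI.rel_approx (g j) n

theorem pi_wayBelow_iff {f g : Fin r → LscI} :
    WayBelow f g ↔ ∀ j, LscI.Rel (f j) (g j) := by
  refine ⟨fun h j => ?_, pi_wayBelow_of_rel⟩
  obtain ⟨n, hn⟩ := h _ (wayBelow_seq_monotone (pi_approx_wayBelow g)) g (pi_isLUB_approx g) le_rfl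
  exact (LscI.rel_approx (g j) n).mono (hn j) (LscI.approx_le _ _)

theorem pi_isCuSemigroup (r : ℕ) : IsCuSemigroup (Fin r → LscI) where
  add_le_add_left x y h z j := LscI.add_le_add' (h j) le_rfl
  zero_le x j := LscI.zero_le' _
  exists_sup z hz := ⟨fun j => LscI.iSup fun n => z n j,
    pi_isLUB_iff.2 fun j => LscI.isLUB_iSup _⟩
  exists_wayBelow_seq x := ⟨_, pi_approx_wayBelow x, pi_isLUB_approx x⟩
  wayBelow_add x' x y' y hx hy := by
    rw [pi_wayBelow_iff] at *
    exact fun j => (hx j).add (hy j)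
  isLUB_add x y hx hy a b ha hb := by
    rw [pi_isLUB_iff] at *
    intro j
    have : a j + b j = LscI.iSup fun n => x n j + y n j := by
      ext t
      rw [LscI.add_apply, LscI.apply_eq_iSup (ha j), LscI.apply_eq_iSup (hb j)]
      exact ENat.iSup_add_iSup_of_monotone (fun m n h => hx h j t) fun m n h => hy h j t
    rw [Pi.add_apply, this]
    exact LscI.isLUB_iSup _

end Pi

/-! ### Indicators of half-lines and intervals -/

namespace LscI

theorem chiIoc_of_lt {t : ℝ} {x : unitInterval} (h : t < x) : (chiIoc t).1 x = 1 :=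
  Set.indicator_of_mem (s := {x : unitInterval | t < (x : ℝ)}) (f := fun _ => (1 : ℕ∞)) h

theorem chiIoc_of_le {t : ℝ} {x : unitInterval} (h : x ≤ t) : (chiIoc t).1 x = 0 :=
  Set.indicator_of_notMem (s := {x : unitInterval | t < (x : ℝ)}) (f := fun _ => (1 : ℕ∞))
    (not_lt.2 h)

theorem chiIoc_anti {s t : ℝ} (h : s ≤ t) : chiIoc t ≤ chiIoc s := by
  intro x
  rcases le_or_gt (x : ℝ) t with hx | hx
  · rw [chiIoc_of_le hx]
    exact zero_le
  · rw [chiIoc_of_lt hx, chiIoc_of_lt (h.trans_lt hx)]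

theorem chiIoc_of_neg {t : ℝ} (h : t < 0) : chiIoc t = one := by
  ext x
  rw [chiIoc_of_lt (h.trans_le x.2.1)]
  rfl

theorem chiIoc_of_one_le {t : ℝ} (h : 1 ≤ t) : chiIoc t = 0 := by
  ext x
  rw [chiIoc_of_le (x.2.2.trans h)]
  rfl

theorem chiIoc_le_one (t : ℝ) : chiIoc t ≤ one := by
  intro x
  rcases le_or_gt (x : ℝ) t with hx | hx
  · rw [chiIoc_of_le hx]
    exact zero_le
  · rw [chiIoc_of_lt hx]
    rfl

theorem rel_one : Rel one one := fun _ => ⟨1, by simp [one], .of_forall fun _ => by simp [one]⟩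

theorem rel_chiIoc {s t : ℝ} (h : s < t) : Rel (chiIoc t) (chiIoc s) := by
  refine rel_chi (isOpen_lt continuous_const continuous_subtype_val)
    (isOpen_lt continuous_const continuous_subtype_val) ?_
  refine (closure_minimal (t := {x : unitInterval | t ≤ (x : ℝ)})
    (Set.ofPred_subset_ofPred.2 fun x hx => le_of_lt hx)
    (isClosed_le continuous_const continuous_subtype_val)).trans fun x hx => ?_
  exact lt_of_lt_of_le h hx

/-- The trace on `[0,1]` of an open interval of the real line. -/
def realIoo (s t : ℝ) : Set unitInterval := {x | s < x ∧ x < t}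

theorem isOpen_realIoo (s t : ℝ) : IsOpen (realIoo s t) :=
  (isOpen_lt continuous_const continuous_subtype_val).inter
    (isOpen_lt continuous_subtype_val continuous_const)

theorem chi_realIoo_add_le {s t : ℝ} (h : s ≤ t) :
    chi (realIoo s t) (isOpen_realIoo s t) + chiIoc t ≤ chiIoc s := by
  intro x
  rw [add_apply]
  rcases le_or_gt (x : ℝ) t with hx | hx
  · rw [chiIoc_of_le hx, add_zero]
    by_cases hs : x ∈ realIoo s t
    · rw [chi_of_mem _ hs, chiIoc_of_lt hs.1]
    · rw [chi_of_notMem _ hs]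
      exact zero_le
  · rw [chiIoc_of_lt hx, chiIoc_of_lt (h.trans_lt hx), chi_of_notMem _ fun hs => hx.not_gt hs.2,
      zero_add]

/-- The overlap `u < t` is needed: `(s,t)` and `(t,1]` together miss the point `t`. -/
theorem chiIoc_le_chi_realIoo_add {s t u : ℝ} (h : u < t) :
    chiIoc s ≤ chi (realIoo s t) (isOpen_realIoo s t) + chiIoc u := by
  intro x
  rw [add_apply]
  rcases le_or_gt (x : ℝ) s with hx | hx
  · rw [chiIoc_of_le hx]
    exact zero_le
  · rw [chiIoc_of_lt hx]
    rcases lt_or_ge (x : ℝ) t with hxt | hxt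
    · rw [chi_of_mem _ (show x ∈ realIoo s t from ⟨hx, hxt⟩)]
      exact le_self_add
    · rw [chiIoc_of_lt (h.trans_le hxt)]
      exact le_add_self

end LscI

/-! ### Closeness on half-lines controls all way-below pairs -/

section Controlled

variable {S : Type*} [AddCommMonoid S] [PartialOrder S]

/-- Monotone homomorphisms out of `LscI` that preserve the way-below relation. -/
structure IsRegular (θ : LscI →+ S) : Prop where
  mono : Monotone θ
  wayBelow : ∀ f g, LscI.Rel f g → WayBelow (θ f) (θ g)

/-- The comparison at level `η` that underlies the distance. -/
def Close (η : ℝ) (θ θ' : LscI →+ S) : Prop :=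
  ∀ t : ℝ, θ (LscI.chiIoc (t + η)) ≤ θ' (LscI.chiIoc t) ∧
    θ' (LscI.chiIoc (t + η)) ≤ θ (LscI.chiIoc t)

theorem Close.symm {η : ℝ} {θ θ' : LscI →+ S} (h : Close η θ θ') : Close η θ' θ :=
  fun t => (h t).symm

theorem Close.mono {η η' : ℝ} {θ θ' : LscI →+ S} (h : Close η θ θ') (hθ : IsRegular θ)
    (hθ' : IsRegular θ') (hη : η ≤ η') : Close η' θ θ' := fun t =>
  ⟨(hθ.mono (LscI.chiIoc_anti (by linarith))).trans (h t).1,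
    (hθ'.mono (LscI.chiIoc_anti (by linarith))).trans (h t).2⟩

/-- The intermediate parameters `t + a` and `t + b` may leave `[0,1]`, hence the quantification over
all real `t` in `Close`. -/
theorem Close.trans {a b : ℝ} {θ₁ θ₂ θ₃ : LscI →+ S} (h : Close a θ₁ θ₂) (h' : Close b θ₂ θ₃) :
    Close (a + b) θ₁ θ₃ := by
  intro t
  constructor
  · refine le_trans ?_ (h' t).1
    convert (h (t + b)).1 using 3
    ring
  · refine le_trans ?_ (h t).2
    convert (h' (t + a)).2 using 3
    ring

theorem close_zero (θ : LscI →+ S) : Close 0 θ θ := fun t => by simp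

variable (S) in
/-- All sufficiently close regular homomorphisms `θ`, `θ'` satisfy `θ f ≤ θ' g`. -/
def Controlled (f g : LscI) : Prop :=
  ∃ η > 0, ∀ θ θ' : LscI →+ S, IsRegular θ → IsRegular θ' → Close η θ θ' → θ f ≤ θ' g

theorem Controlled.mono {f f' g g' : LscI} (h : Controlled S f g) (hf : f' ≤ f) (hg : g ≤ g') :
    Controlled S f' g' := by
  obtain ⟨η, hη, H⟩ := h
  exact ⟨η, hη, fun θ θ' hθ hθ' hc => (hθ.mono hf).trans ((H θ θ' hθ hθ' hc).trans (hθ'.mono hg))⟩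

theorem controlled_zero (hS : IsCuSemigroup S) (g : LscI) : Controlled S 0 g :=
  ⟨1, one_pos, fun θ θ' _ _ _ => by rw [map_zero]; exact hS.zero_le _⟩

theorem Controlled.add (hS : IsCuSemigroup S) {f f' g g' : LscI} (h : Controlled S f g)
    (h' : Controlled S f' g') : Controlled S (f + f') (g + g') := by
  obtain ⟨η, hη, H⟩ := h
  obtain ⟨η', hη', H'⟩ := h'
  refine ⟨min η η', lt_min hη hη', fun θ θ' hθ hθ' hc => ?_⟩
  rw [map_add, map_add]
  exact hS.add_le_add (H θ θ' hθ hθ' (hc.mono hθ hθ' (min_le_left _ _)))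
    (H' θ θ' hθ hθ' (hc.mono hθ hθ' (min_le_right _ _)))

theorem Controlled.sum (hS : IsCuSemigroup S) {ι : Type*} (s : Finset ι) {f g : ι → LscI}
    (h : ∀ i ∈ s, Controlled S (f i) (g i)) : Controlled S (∑ i ∈ s, f i) (∑ i ∈ s, g i) := by
  classical
  induction s using Finset.induction_on with
  | empty => simpa using controlled_zero hS 0
  | insert i s hi ih =>
    rw [Finset.sum_insert hi, Finset.sum_insert hi]
    exact (h i (by simp)).add hS (ih fun k hk => h k (by simp [hk]))

/-- Add `θ' χ_(t-η,1]` to both sides. The left sum is at most `θ χ_(s+2η,1] ≪ θ χ_(s+η,1] ≤ θ'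
χ_(s,1]`, which is at most the right sum; then cancel. At each end one `η` pays for the comparison.
The other makes `≪` available on the left and provides the overlap on the right. -/
theorem controlled_realIoo (hS : IsCuSemigroup S) (hwc : WeaklyCancellative S) {s t η : ℝ}
    (hη : 0 < η) (hst : s + 2 * η ≤ t - 2 * η) :
    Controlled S (LscI.chi (LscI.realIoo (s + 2 * η) (t - 2 * η)) (LscI.isOpen_realIoo _ _))
      (LscI.chi (LscI.realIoo s t) (LscI.isOpen_realIoo _ _)) := by
  refine ⟨η, hη, fun θ θ' hθ hθ' hc => ?_⟩
  refine (hwc _ _ (θ' (LscI.chiIoc (t - η))) ?_).le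
  refine (hθ.wayBelow _ _ (LscI.rel_chiIoc (show s + η < s + 2 * η by linarith))).mono ?_ ?_
  · have h1 : θ' (LscI.chiIoc (t - η)) ≤ θ (LscI.chiIoc (t - 2 * η)) := by
      convert (hc (t - 2 * η)).2 using 3
      ring
    refine (hS.add_le_add le_rfl h1).trans ?_
    rw [← map_add]
    exact hθ.mono (LscI.chi_realIoo_add_le hst)
  · refine (hc s).1.trans ?_
    rw [← map_add]
    exact hθ'.mono (LscI.chiIoc_le_chi_realIoo_add (by linarith))

theorem exists_controlled_of_ordConnected (hS : IsCuSemigroup S) (hwc : WeaklyCancellative S)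
    {I K : Set unitInterval} (hI : IsOpen I) (hc : I.OrdConnected) (hK : IsClosed K)
    (hKI : K ⊆ I) : ∃ V, ∃ hV : IsOpen V, K ⊆ V ∧ Controlled S (LscI.chi V hV) (LscI.chi I hI) := by
  rcases K.eq_empty_or_nonempty with rfl | hne
  · refine ⟨∅, isOpen_empty, le_rfl, (controlled_zero hS _).mono (fun x => ?_) le_rfl⟩
    rw [LscI.chi_of_notMem _ (Set.notMem_empty x)]
    exact zero_le
  obtain ⟨a, haK, ha⟩ := hK.isCompact.exists_isLeast hne
  obtain ⟨b, hbK, hb⟩ := hK.isCompact.exists_isGreatest hne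
  obtain ⟨u, hu, hua⟩ := Metric.isOpen_iff.1 hI a (hKI haK)
  obtain ⟨v, hv, hvb⟩ := Metric.isOpen_iff.1 hI b (hKI hbK)
  -- The outer interval `(a - 3η, b + 3η)` must stay in `I`, while shrinking it by `2η` at each end
  -- still leaves a margin `η` around `[a,b] ⊇ K`.
  obtain ⟨η, hη, hηu, hηv⟩ : ∃ η > 0, 3 * η ≤ u ∧ 3 * η ≤ v :=
    ⟨min u v / 3, by positivity, by linarith [min_le_left u v], by linarith [min_le_right u v]⟩
  have hab : (a : ℝ) ≤ b := ha hbK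
  refine ⟨_, LscI.isOpen_realIoo _ _, ?_, (controlled_realIoo hS hwc (s := a - 3 * η)
    (t := b + 3 * η) hη (by linarith)).mono le_rfl (LscI.chi_mono _ _ ?_)⟩
  · intro x hx
    have h1 : (a : ℝ) ≤ x := ha hx
    have h2 : (x : ℝ) ≤ b := hb hx
    exact ⟨by linarith, by linarith⟩
  · rintro x ⟨h1, h2⟩
    rcases le_total x a with hxa | hxa
    · refine hua ?_
      have : (x : ℝ) ≤ a := hxa
      rw [Metric.mem_ball, Subtype.dist_eq, Real.dist_eq, abs_lt]
      exact ⟨by linarith, by linarith⟩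
    rcases le_total b x with hxb | hxb
    · refine hvb ?_
      have : (b : ℝ) ≤ x := hxb
      rw [Metric.mem_ball, Subtype.dist_eq, Real.dist_eq, abs_lt]
      exact ⟨by linarith, by linarith⟩
    exact hc.out (hKI haK) (hKI hbK) ⟨hxa, hxb⟩

/-- Removing the other intervals from `K` leaves a closed subset of `W i`, so the one-interval case
applies to each piece. The resulting indicators sum to at least `χ_V`, and by disjointness the `χ_(W
i)` sum to at most `χ_U`. -/
theorem controlled_of_disjoint_intervals (hS : IsCuSemigroup S) (hwc : WeaklyCancellative S)
    {ι : Type*} [Fintype ι] {W : ι → Set unitInterval} (hW : ∀ i, IsOpen (W i))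
    (hc : ∀ i, (W i).OrdConnected) (hdisj : Pairwise fun i j => Disjoint (W i) (W j))
    {K V U : Set unitInterval} (hK : IsClosed K) (hKW : K ⊆ ⋃ i, W i) (hV : IsOpen V)
    (hVK : V ⊆ K) (hU : IsOpen U) (hWU : ∀ i, W i ⊆ U) :
    Controlled S (LscI.chi V hV) (LscI.chi U hU) := by
  classical
  have key : ∀ i, ∃ P, ∃ hP : IsOpen P, (K \ ⋃ j ∈ {j | j ≠ i}, W j) ⊆ P ∧
      Controlled S (LscI.chi P hP) (LscI.chi (W i) (hW i)) := by
    intro i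
    refine exists_controlled_of_ordConnected hS hwc (hW i) (hc i)
      (hK.sdiff (isOpen_biUnion fun j _ => hW j)) ?_
    rintro x ⟨hx, hx'⟩
    obtain ⟨j, hj⟩ := Set.mem_iUnion.1 (hKW hx)
    by_cases hji : j = i
    · exact hji ▸ hj
    · exact (hx' (Set.mem_biUnion (show j ∈ {j | j ≠ i} from hji) hj)).elim
  choose P hP hKP hctrl using key
  refine (Controlled.sum hS Finset.univ fun i _ => hctrl i).mono (fun x => ?_) fun x => ?_
  · rw [LscI.sum_apply]
    by_cases hx : x ∈ V
    · obtain ⟨i, hi⟩ := Set.mem_iUnion.1 (hKW (hVK hx))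
      have hxi : x ∈ P i := by
        refine hKP i ⟨hVK hx, fun hx' => ?_⟩
        obtain ⟨j, hj, hxj⟩ := Set.mem_iUnion₂.1 hx'
        exact Set.disjoint_left.1 (hdisj hj) hxj hi
      rw [LscI.chi_of_mem hV hx, ← LscI.chi_of_mem (hP i) hxi]
      exact Finset.single_le_sum (f := fun i => (LscI.chi (P i) (hP i)).1 x)
        (fun _ _ => zero_le) (Finset.mem_univ i)
    · rw [LscI.chi_of_notMem hV hx]
      exact zero_le
  · rw [LscI.sum_apply]
    by_cases hx : ∃ i, x ∈ W i
    · obtain ⟨i, hi⟩ := hx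
      rw [Finset.sum_eq_single_of_mem i (Finset.mem_univ i), LscI.chi_of_mem (hW i) hi,
        LscI.chi_of_mem hU (hWU i hi)]
      exact fun j _ hj => LscI.chi_of_notMem _ fun hxj => Set.disjoint_left.1 (hdisj hj) hxj hi
    · push Not at hx
      rw [Finset.sum_eq_zero fun i _ => LscI.chi_of_notMem (hW i) (hx i)]
      exact zero_le

theorem isOpen_ordConnectedComponent {U : Set unitInterval} (hU : IsOpen U) (x : unitInterval) :
    IsOpen (U.ordConnectedComponent x) := by
  refine isOpen_iff_mem_nhds.2 fun y hy => ?_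
  rw [Set.ordConnectedComponent_eq (Set.mem_ordConnectedComponent.1 hy),
    Set.ordConnectedComponent_mem_nhds]
  exact hU.mem_nhds (Set.ordConnectedComponent_subset hy)

theorem controlled_chi (hS : IsCuSemigroup S) (hwc : WeaklyCancellative S)
    {V U : Set unitInterval} (hV : IsOpen V) (hU : IsOpen U) (h : closure V ⊆ U) :
    Controlled S (LscI.chi V hV) (LscI.chi U hU) := by
  classical
  obtain ⟨t, ht, hcov⟩ := (isClosed_closure (s := V)).isCompact.elim_nhds_subcover
    (fun x => U.ordConnectedComponent x)
    fun x hx => Set.ordConnectedComponent_mem_nhds.2 (hU.mem_nhds (h hx))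
  -- Indexing by components rather than by points of `t` removes repetitions, so distinct indices
  -- give disjoint sets.
  let 𝒲 : Finset (Set unitInterval) := t.image U.ordConnectedComponent
  have h𝒲 : ∀ W : 𝒲, ∃ x, U.ordConnectedComponent x = W := by
    rintro ⟨W, hW⟩
    obtain ⟨x, hx, rfl⟩ := Finset.mem_image.1 hW
    exact ⟨x, rfl⟩
  refine controlled_of_disjoint_intervals hS hwc (W := fun W : 𝒲 => (W : Set unitInterval))
    (fun W => ?_) (fun W => ?_) (fun W W' hne => ?_) isClosed_closure ?_ hV subset_closure hU
    fun W => ?_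
  · obtain ⟨x, hx⟩ := h𝒲 W
    rw [← hx]
    exact isOpen_ordConnectedComponent hU x
  · obtain ⟨x, hx⟩ := h𝒲 W
    rw [← hx]
    infer_instance
  · obtain ⟨x, hx⟩ := h𝒲 W
    obtain ⟨y, hy⟩ := h𝒲 W'
    refine Set.disjoint_left.2 fun z hz hz' => hne (Subtype.ext ?_)
    rw [← hx] at hz ⊢
    rw [← hy] at hz' ⊢
    rw [Set.ordConnectedComponent_eq (Set.mem_ordConnectedComponent.1 hz),
      Set.ordConnectedComponent_eq (Set.mem_ordConnectedComponent.1 hz')]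
  · intro x hx
    obtain ⟨y, hy, hxy⟩ := Set.mem_iUnion₂.1 (hcov hx)
    exact Set.mem_iUnion.2 ⟨⟨_, Finset.mem_image_of_mem _ hy⟩, hxy⟩
  · obtain ⟨x, hx⟩ := h𝒲 W
    rw [← hx]
    exact Set.ordConnectedComponent_subset

theorem controlled_of_rel (hS : IsCuSemigroup S) (hwc : WeaklyCancellative S) {f g : LscI}
    (h : LscI.Rel f g) : Controlled S f g := by
  obtain ⟨n, hn⟩ := h.wayBelow _ (monotone_nat_of_le_succ fun n => (LscI.rel_approx g n).wayBelow.le)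
    g (LscI.isLUB_approx g) le_rfl
  exact (Controlled.sum hS (Finset.range n) fun k _ =>
    controlled_chi hS hwc (LscI.isOpen_inner (LscI.level g k) n) (LscI.isOpen_level g k)
      ((LscI.closure_inner_subset _ n).trans (LscI.inner_subset _ _))).mono hn
        (LscI.sum_range_chi_le g n)

end Controlled

/-! ### From the distance to convergence and uniqueness -/

section Dist

variable {S : Type*} [AddCommMonoid S] [PartialOrder S]

theorem distI_nonneg (θ θ' : LscI →+ S) : 0 ≤ distI θ θ' :=
  Real.sInf_nonneg fun _ h => h.1.1

theorem distI_le_of_close {η : ℝ} {θ θ' : LscI →+ S} (h0 : 0 ≤ η) (h1 : η ≤ 1)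
    (h : Close η θ θ') : distI θ θ' ≤ η :=
  csInf_le ⟨0, fun _ h => h.1.1⟩ ⟨⟨h0, h1⟩, fun t _ => h t⟩

/-- The distance tests only `t ∈ [0,1]`. For `t < 0` the larger side is the value at `1`, where the
maps agree; for `t > 1` the case `t = 1` suffices. -/
theorem close_of_distI_lt (hS : IsCuSemigroup S) {η : ℝ} {θ θ' : LscI →+ S} (hθ : IsRegular θ)
    (hθ' : IsRegular θ') (hone : θ LscI.one = θ' LscI.one) (h : distI θ θ' < η) :
    Close η θ θ' := by
  have hne : {e : ℝ | e ∈ Set.Icc (0 : ℝ) 1 ∧ ∀ t ∈ Set.Icc (0 : ℝ) 1,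
      θ (LscI.chiIoc (t + e)) ≤ θ' (LscI.chiIoc t) ∧
      θ' (LscI.chiIoc (t + e)) ≤ θ (LscI.chiIoc t)}.Nonempty := by
    -- The value `1` is always admissible, because `χ_(t+1,1] = 0` for `t ≥ 0`.
    refine ⟨1, ⟨zero_le_one, le_rfl⟩, fun t ht => ?_⟩
    rw [LscI.chiIoc_of_one_le (by linarith [ht.1]), map_zero, map_zero]
    exact ⟨hS.zero_le _, hS.zero_le _⟩
  obtain ⟨e, ⟨-, he⟩, heη⟩ := exists_lt_of_csInf_lt hne h
  refine Close.mono (η := e) (fun t => ?_) hθ hθ' heη.le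
  rcases lt_or_ge t 0 with ht | ht
  · rw [LscI.chiIoc_of_neg ht]
    exact ⟨(hθ.mono (LscI.chiIoc_le_one _)).trans hone.le,
      (hθ'.mono (LscI.chiIoc_le_one _)).trans hone.ge⟩
  · rcases le_or_gt t 1 with ht1 | ht1
    · exact he t ⟨ht, ht1⟩
    · rw [LscI.chiIoc_of_one_le ht1.le]
      have h1 := he 1 ⟨zero_le_one, le_rfl⟩
      rw [LscI.chiIoc_of_one_le le_rfl] at h1
      exact ⟨(hθ.mono (LscI.chiIoc_anti (by linarith))).trans h1.1,
        (hθ'.mono (LscI.chiIoc_anti (by linarith))).trans h1.2⟩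

variable {r : ℕ}

theorem CuMorphism.isRegular_restrict (φ : CuMorphism (Fin r → LscI) S) (j : Fin r) :
    IsRegular (φ.restrict j) where
  mono f g h := φ.mono (Pi.single_mono j h)
  wayBelow f g h := φ.map_wayBelow (pi_wayBelow_of_rel fun k => by
    by_cases hk : k = j
    · subst hk
      simpa using h
    · simpa [hk] using LscI.rel_zero 0)

theorem CuMorphism.eq_sum_restrict (φ : CuMorphism (Fin r → LscI) S) (f : Fin r → LscI) :
    φ f = ∑ j, φ.restrict j (f j) := by
  conv_lhs => rw [← Finset.univ_sum_single f]
  exact map_sum φ.toAddMonoidHom _ _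

theorem distI_le_cuDist (φ ψ : CuMorphism (Fin r → LscI) S) (j : Fin r) :
    distI (φ.restrict j) (ψ.restrict j) ≤ cuDist φ ψ :=
  le_ciSup (f := fun j => distI (φ.restrict j) (ψ.restrict j)) (Set.finite_range _).bddAbove j

theorem cuDist_nonneg (φ ψ : CuMorphism (Fin r → LscI) S) : 0 ≤ cuDist φ ψ :=
  Real.iSup_nonneg fun _ => distI_nonneg _ _

theorem close_of_cuDist_lt (hS : IsCuSemigroup S) {η : ℝ} {φ ψ : CuMorphism (Fin r → LscI) S}
    (hunit : ∀ j, φ (unit j) = ψ (unit j)) (h : cuDist φ ψ < η) (j : Fin r) :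
    Close η (φ.restrict j) (ψ.restrict j) :=
  close_of_distI_lt hS (φ.isRegular_restrict j) (ψ.isRegular_restrict j) (hunit j)
    ((distI_le_cuDist φ ψ j).trans_lt h)

/-- Componentwise close morphisms are comparable on a way-below pair. -/
theorem exists_le_of_wayBelow (hS : IsCuSemigroup S) (hwc : WeaklyCancellative S)
    {f g : Fin r → LscI} (h : WayBelow f g) :
    ∃ η > 0, ∀ φ ψ : CuMorphism (Fin r → LscI) S,
      (∀ j, Close η (φ.restrict j) (ψ.restrict j)) → φ f ≤ ψ g := by
  choose η hη H using fun j => controlled_of_rel hS hwc (pi_wayBelow_iff.1 h j)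
  obtain ⟨δ, hδ, hle⟩ : ∃ δ > 0, ∀ j, δ ≤ η j := by
    rcases isEmpty_or_nonempty (Fin r) with he | he
    · exact ⟨1, one_pos, fun j => he.elim j⟩
    · exact ⟨Finset.univ.inf' Finset.univ_nonempty η, (Finset.lt_inf'_iff _).2 fun j _ => hη j,
        fun j => Finset.inf'_le _ (Finset.mem_univ j)⟩
  refine ⟨δ, hδ, fun φ ψ hc => ?_⟩
  rw [φ.eq_sum_restrict, ψ.eq_sum_restrict]
  exact hS.sum_le_sum _ fun j _ => H j _ _ (φ.isRegular_restrict j) (ψ.isRegular_restrict j)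
    ((hc j).mono (φ.isRegular_restrict j) (ψ.isRegular_restrict j) (hle j))

theorem CuMorphism.le_of_close (hS : IsCuSemigroup S) (hwc : WeaklyCancellative S)
    {φ ψ : CuMorphism (Fin r → LscI) S}
    (h : ∀ η > 0, ∀ j, Close η (φ.restrict j) (ψ.restrict j)) (f : Fin r → LscI) : φ f ≤ ψ f := by
  refine (φ.map_isLUB' _ (wayBelow_seq_monotone (pi_approx_wayBelow f)) f
    (pi_isLUB_approx f)).2 ?_
  rintro _ ⟨n, rfl⟩
  obtain ⟨η, hη, H⟩ := exists_le_of_wayBelow hS hwc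
    (wayBelow_seq_lub (pi_approx_wayBelow f) (pi_isLUB_approx f) n)
  exact H φ ψ (h η hη)

/-- A sequence of `Cu`-morphisms converges to at most one morphism with the same units. -/
theorem limit_unique (hS : IsCuSemigroup S) (hwc : WeaklyCancellative S)
    {φ : ℕ → CuMorphism (Fin r → LscI) S} {ψ₁ ψ₂ : CuMorphism (Fin r → LscI) S}
    (h₁ : Tendsto (fun i => cuDist ψ₁ (φ i)) atTop (𝓝 0))
    (hu₁ : ∀ i j, ψ₁ (unit j) = φ i (unit j))
    (h₂ : Tendsto (fun i => cuDist ψ₂ (φ i)) atTop (𝓝 0))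
    (hu₂ : ∀ i j, ψ₂ (unit j) = φ i (unit j)) : ψ₁ = ψ₂ := by
  have hclose : ∀ η > 0, ∀ j, Close η (ψ₁.restrict j) (ψ₂.restrict j) := by
    intro η hη j
    obtain ⟨i, hi₁, hi₂⟩ := ((h₁.eventually_lt_const (half_pos hη)).and
      (h₂.eventually_lt_const (half_pos hη))).exists
    have := (close_of_cuDist_lt hS (hu₁ i) hi₁ j).trans (close_of_cuDist_lt hS (hu₂ i) hi₂ j).symm
    rwa [add_halves] at this
  exact DFunLike.ext _ _ fun f => le_antisymm (CuMorphism.le_of_close hS hwc hclose f)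
    (CuMorphism.le_of_close hS hwc (fun η hη j => (hclose η hη j).symm) f)

theorem exists_close_of_summable (hS : IsCuSemigroup S) {φ : ℕ → CuMorphism (Fin r → LscI) S}
    (hunit : ∀ i j, φ i (unit j) = φ (i + 1) (unit j)) {ε : ℕ → ℝ} (hε : Summable ε)
    (hdist : ∀ i, cuDist (φ i) (φ (i + 1)) < ε i) {η : ℝ} (hη : 0 < η) :
    ∃ N, ∀ i ≥ N, ∀ k ≥ N, ∀ j, Close η ((φ i).restrict j) ((φ k).restrict j) := by
  -- Writing the accumulated error as a difference of partial sums lets the Cauchy property of the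
  -- series bound it directly.
  have hsum : ∀ i n j, Close (∑ m ∈ Finset.range (i + n), ε m - ∑ m ∈ Finset.range i, ε m)
      ((φ i).restrict j) ((φ (i + n)).restrict j) := by
    intro i n j
    induction n with
    | zero => simpa using close_zero _
    | succ n ih =>
      have := ih.trans (close_of_cuDist_lt hS (hunit (i + n)) (hdist (i + n)) j)
      rw [← add_assoc, Finset.sum_range_succ]
      convert this using 1
      ring
  obtain ⟨N, hN⟩ := Metric.cauchySeq_iff.1 hε.hasSum.tendsto_sum_nat.cauchySeq η hη
  have hlt : ∀ i ≥ N, ∀ n j, Close η ((φ i).restrict j) ((φ (i + n)).restrict j) := fun i hi n j =>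
    (hsum i n j).mono ((φ _).isRegular_restrict j) ((φ _).isRegular_restrict j)
      ((le_abs_self _).trans (hN (i + n) (by omega) i hi).le)
  refine ⟨N, fun i hi k hk j => ?_⟩
  rcases le_total i k with h | h
  · obtain ⟨n, rfl⟩ := Nat.exists_eq_add_of_le h
    exact hlt i hi n j
  · obtain ⟨n, rfl⟩ := Nat.exists_eq_add_of_le h
    exact (hlt k hk n j).symm

theorem unit_wayBelow_unit (j : Fin r) : WayBelow (unit j) (unit j) :=
  pi_wayBelow_of_rel fun k => by
    by_cases hk : k = j
    · subst hk
      simpa [unit] using LscI.rel_one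
    · simpa [unit, hk] using LscI.rel_zero 0

theorem single_chiIoc_wayBelow {s t : ℝ} (h : s < t) (j : Fin r) :
    WayBelow (Pi.single j (LscI.chiIoc t) : Fin r → LscI) (Pi.single j (LscI.chiIoc s)) :=
  pi_wayBelow_of_rel fun k => by
    by_cases hk : k = j
    · subst hk
      simpa using LscI.rel_chiIoc h
    · simpa [hk] using LscI.rel_zero 0

theorem tendsto_cuDist_of_limit {φ : ℕ → CuMorphism (Fin r → LscI) S}
    (hφ : ∀ η > 0, ∃ N, ∀ i ≥ N, ∀ k ≥ N, ∀ j, Close η ((φ i).restrict j) ((φ k).restrict j))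
    {ψ : CuMorphism (Fin r → LscI) S}
    (hψ : ∀ f g, WayBelow f g → ∃ N, ∀ i ≥ N, φ i f ≤ ψ g ∧ ψ f ≤ φ i g) :
    Tendsto (fun i => cuDist ψ (φ i)) atTop (𝓝 0) := by
  refine Metric.tendsto_atTop.2 fun δ hδ => ?_
  -- One `η` provides the way-below pair comparing `ψ` with a late `φ k`, the other compares `φ k`
  -- with `φ i`. The bound by `1` is built into the definition of the distance.
  obtain ⟨η, hη, hη1, hηδ⟩ : ∃ η > 0, η + η ≤ 1 ∧ η + η < δ :=
    ⟨min 1 δ / 4, by positivity, by linarith [min_le_left 1 δ], by linarith [min_le_right 1 δ]⟩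
  obtain ⟨N, hN⟩ := hφ η hη
  refine ⟨N, fun i hi => ?_⟩
  rw [Real.dist_0_eq_abs, abs_of_nonneg (cuDist_nonneg _ _)]
  refine lt_of_le_of_lt (Real.iSup_le (fun j => ?_) (by linarith)) hηδ
  refine distI_le_of_close (by linarith) hη1 fun t => ?_
  constructor
  · obtain ⟨M, hM⟩ := hψ _ _ (single_chiIoc_wayBelow (show t + η < t + (η + η) by linarith) j)
    exact (hM (max M N) (le_max_left _ _)).2.trans
      (hN _ (le_max_right _ _) i hi j t).1
  · obtain ⟨M, hM⟩ := hψ _ _ (single_chiIoc_wayBelow (show t < t + η by linarith) j)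
    refine le_trans ?_ (hM (max M N) (le_max_left _ _)).1
    rw [← add_assoc]
    exact (hN i hi _ (le_max_right _ _) j (t + η)).1

end Dist

end Cuntz

/-! ### Existence and uniqueness of the limit -/

theorem mainTheorem7 {S : Type*} [AddCommMonoid S] [PartialOrder S]
    (hS : Cuntz.IsCuSemigroup S) (hO5 : Cuntz.O5 S) (hwc : Cuntz.WeaklyCancellative S)
    (r : ℕ) (φ : ℕ → Cuntz.CuMorphism (Fin r → Cuntz.LscI) S)
    (hunit : ∀ (i : ℕ) (j : Fin r), φ i (Cuntz.unit j) = φ (i + 1) (Cuntz.unit j))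
    (ε : ℕ → ℝ) (hε : Summable ε)
    (hdist : ∀ i : ℕ, Cuntz.cuDist (φ i) (φ (i + 1)) < ε i) :
    ∃! ψ : Cuntz.CuMorphism (Fin r → Cuntz.LscI) S,
      Filter.Tendsto (fun i => Cuntz.cuDist ψ (φ i)) Filter.atTop (nhds 0) ∧
        ∀ (i : ℕ) (j : Fin r), ψ (Cuntz.unit j) = φ i (Cuntz.unit j) := by
  have hclose := fun (η : ℝ) (hη : η > 0) =>
    Cuntz.exists_close_of_summable hS hunit hε hdist hη
  have hcauchy : Cuntz.WayBelowCauchy φ := fun f g h => by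
    obtain ⟨η, hη, H⟩ := Cuntz.exists_le_of_wayBelow hS hwc h
    obtain ⟨N, hN⟩ := hclose η hη
    exact ⟨N, fun i hi k hk => H _ _ (hN i hi k hk)⟩
  obtain ⟨ψ, hψ⟩ := hcauchy.exists_limit hS (Cuntz.pi_isCuSemigroup r)
  have hconst : ∀ (i : ℕ) (j : Fin r), φ i (Cuntz.unit j) = φ 0 (Cuntz.unit j) := by
    intro i j
    induction i with
    | zero => rfl
    | succ i ih => rw [← hunit, ih]
  have hlim := Cuntz.tendsto_cuDist_of_limit hclose hψ
  have hunits : ∀ (i : ℕ) (j : Fin r), ψ (Cuntz.unit j) = φ i (Cuntz.unit j) := by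
    intro i j
    -- As `1_j ≪ 1_j`, the limit property with `f = g = 1_j` gives both inequalities, hence exact
    -- equality on units.
    obtain ⟨N, hN⟩ := hψ _ _ (Cuntz.unit_wayBelow_unit j)
    have := hN N le_rfl
    rw [hconst] at this ⊢
    exact le_antisymm this.2 this.1
  exact ⟨ψ, ⟨hlim, hunits⟩, fun ψ' h => Cuntz.limit_unique hS hwc h.1 h.2 hlim hunits⟩
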